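/- Let $a\in\mathbb{C}$, $a\neq 0$, and let $F:\mathbb{C}^2\to\mathbb{C}^2$, $F(z,w)=(z^2,\,w^2+az)$. Let $\Omega$ be the immediate basin of attraction of the fixed point $(0,0)$, that is, the connected component containing $(0,0)$ of the set of points $x\in\mathbb{C}^2$ with $F^n(x)\to(0,0)$. For $x\in\Omega$ and $\xi\in\mathbb{C}^2$ put $$K_\Omega(x,\xi)=\inf\{r>0:\ \text{there is a holomorphic } f:\triangle\to\Omega \text{ with } f(0)=x,\ r f'(0)=\xi\},$$ where $\triangle$ is the unit disc in $\mathbb{C}$, and let $$d_\Omega(x,y)=\inf_\gamma\int_0^1 K_\Omega(\gamma(t),\gamma'(t))\,dt$$ be the Kobayashi distance on $\Omega$, the infimum being over all piecewise smooth curves $\gamma:[0,1]\to\Omega$ with $\gamma(0)=x$, $\gamma(1)=y$. Then there is $\varepsilon_0>0$, depending only on $a$, such that for every real $\varepsilon$ with $0<\varepsilon<\varepsilon_0$ and every $C>0$ there exists a point $(z_0,w_0)\in\Omega$ such that every $(\tilde z,\tilde w)\in\bigcup_{k\ge0}F^{-k}(\varepsilon,0)$ lies in $\Omega$ and satisfies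 $$d_\Omega\big((z_0,w_0),(\tilde z,\tilde w)\big)\ge C.$$ -/

import Mathlib

open Set Filter Topology MeasureTheory
open scoped ENNReal ContDiff

/-- The skew product `F(z, w) = (z², w² + a z)` on `ℂ²`. -/
def skewMap (a : ℂ) (p : ℂ × ℂ) : ℂ × ℂ :=
  (p.1 ^ 2, p.2 ^ 2 + a * p.1)

/-- The basin of attraction of `x₀`: the points whose forward orbit converges to `x₀`. -/
def attractingBasin (F : ℂ × ℂ → ℂ × ℂ) (x₀ : ℂ × ℂ) : Set (ℂ × ℂ) :=
  {x | Tendsto (fun n : ℕ => F^[n] x) atTop (𝓝 x₀)}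

/-- The immediate basin: the connected component of the basin that contains `x₀`. -/
def immediateBasin (F : ℂ × ℂ → ℂ × ℂ) (x₀ : ℂ × ℂ) : Set (ℂ × ℂ) :=
  connectedComponentIn (attractingBasin F x₀) x₀

/-- The infinitesimal Kobayashi metric of `Ω ⊆ ℂ²` at the point `x` in the direction `ξ`:
the infimum of all `r > 0` for which there is a holomorphic map `f` from the unit disc to `Ω`
with `f 0 = x` and `r f'(0) = ξ`. -/
noncomputable def kobayashiMetric (Ω : Set (ℂ × ℂ)) (x ξ : ℂ × ℂ) : ℝ≥0∞ :=
  sInf {s : ℝ≥0∞ | ∃ (r : ℝ) (f : ℂ → ℂ × ℂ), 0 < r ∧ s = ENNReal.ofReal r ∧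
    DifferentiableOn ℂ f (Metric.ball 0 1) ∧ MapsTo f (Metric.ball 0 1) Ω ∧
    f 0 = x ∧ (r : ℂ) • deriv f 0 = ξ}

/-- `γ`, restricted to `[0, 1]`, is a piecewise smooth curve: it is continuous, and there is a
finite partition of `[0, 1]` such that `γ` is smooth on each closed subinterval. -/
def PiecewiseSmooth (γ : ℝ → ℂ × ℂ) : Prop :=
  ContinuousOn γ (Icc 0 1) ∧
    ∃ (n : ℕ) (t : ℕ → ℝ), Monotone t ∧ t 0 = 0 ∧ t n = 1 ∧
      ∀ i < n, ContDiffOn ℝ ∞ γ (Icc (t i) (t (i + 1)))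

/-- The Kobayashi length of the curve `γ` on `[0, 1]`. The finitely many break points, where
`deriv γ` may be meaningless, do not contribute. -/
noncomputable def kobayashiLength (Ω : Set (ℂ × ℂ)) (γ : ℝ → ℂ × ℂ) : ℝ≥0∞ :=
  ∫⁻ t in Icc (0 : ℝ) 1, kobayashiMetric Ω (γ t) (deriv γ t)

/-- The Kobayashi distance on `Ω`: the infimum of the Kobayashi lengths of the piecewise smooth
curves in `Ω` from `x` to `y`. -/
noncomputable def kobayashiDist (Ω : Set (ℂ × ℂ)) (x y : ℂ × ℂ) : ℝ≥0∞ :=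
  sInf {L : ℝ≥0∞ | ∃ γ : ℝ → ℂ × ℂ, PiecewiseSmooth γ ∧ MapsTo γ (Icc 0 1) Ω ∧
    γ 0 = x ∧ γ 1 = y ∧ L = kobayashiLength Ω γ}

/-! The base point is `(0, exp (-s))`, close to the edge of the disc `z = 0`, `|w| < 1`. A curve
from it to a backward orbit point is long for one of two reasons. If `|z|` comes close to `1`,
projecting to the unit disc gives the length (`le_kobayashiLength_of_fst`). Otherwise a fixed number
`m` of iterations makes `z` uniformly small on the curve.

In the second case let `W` be the second coordinate of `F^n`, `n ≥ m`. Where the second coordinate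
of `F^m` is at least `1/4` in modulus, `w²` dominates `a z` from then on, so every later iterate has
nonzero second coordinate. This persists on holomorphic discs of a radius `r` that does not depend
on `n` (`exists_radius_iterate_ne_zero`). There `W` maps into a punctured disc of radius `M = |a| +
2`, and lengths dominate `(r/2) |d log log (M/|W|)|`. Elsewhere `|W|` is already at most `c`, of
size `2^(-2^(n-m))`, and so it is at backward orbit points with small `z`
(`iterate_snd_le_of_mem_preimage`). At the base point `log (1/|W|) = 2^n s`, so for large `n` the
ratio of logarithms is governed by `2^m s` alone, and a small `s` makes the length exceed `C`
(`le_kobayashiLength_of_snd`). -/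

/-! ### Schwarz-type derivative estimates -/

/-- Schwarz's lemma for maps of the unit disc into the left half-plane. -/
theorem norm_deriv_le_of_re_neg {ψ : ℂ → ℂ} (hd : DifferentiableOn ℂ ψ (Metric.ball 0 1))
    (hre : ∀ ζ ∈ Metric.ball (0 : ℂ) 1, (ψ ζ).re < 0) :
    ‖deriv ψ 0‖ ≤ 2 * (-(ψ 0).re) := by
  have h0 : (0 : ℂ) ∈ Metric.ball (0 : ℂ) 1 := by simp
  set b := ψ 0 with hb
  have hb0 : b.re < 0 := hre 0 h0
  have hden : ∀ ζ ∈ Metric.ball (0 : ℂ) 1, ψ ζ + (starRingEnd ℂ) b ≠ 0 := by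
    intro ζ hζ h
    have h1 := congrArg Complex.re h
    have h2 := hre ζ hζ
    simp at h1
    linarith
  -- Cayley transform centred at `b`; it lands in the unit disc because `|ψ + conj b|² - |ψ - b|² =
  -- 4 (Re ψ)(Re b) > 0`.
  set φ : ℂ → ℂ := fun ζ => (ψ ζ - b) / (ψ ζ + (starRingEnd ℂ) b) with hφ
  have hφd : DifferentiableOn ℂ φ (Metric.ball 0 1) :=
    (hd.sub_const _).div (hd.add_const _) hden
  have hφ0 : φ 0 = 0 := by simp [hφ, ← hb]
  have hmaps : MapsTo φ (Metric.ball 0 1) (Metric.closedBall (φ 0) 1) := by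
    intro ζ hζ
    rw [hφ0, mem_closedBall_zero_iff]
    simp only [hφ, norm_div]
    apply div_le_one_of_le₀ _ (norm_nonneg _)
    apply le_of_sq_le_sq _ (norm_nonneg _)
    rw [← Complex.normSq_eq_norm_sq, ← Complex.normSq_eq_norm_sq, Complex.normSq_apply,
      Complex.normSq_apply]
    simp only [Complex.sub_re, Complex.sub_im, Complex.add_re, Complex.add_im, Complex.conj_re,
      Complex.conj_im]
    nlinarith [mul_pos_of_neg_of_neg hb0 (hre ζ hζ)]
  have key := Complex.norm_deriv_le_div_of_mapsTo_ball hφd hmaps one_pos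
  have hψ : HasDerivAt ψ (deriv ψ 0) 0 :=
    (hd.differentiableAt (Metric.ball_mem_nhds 0 one_pos)).hasDerivAt
  have hder : HasDerivAt φ (deriv ψ 0 / (b + (starRingEnd ℂ) b)) 0 := by
    refine ((hψ.sub_const b).div (hψ.add_const ((starRingEnd ℂ) b)) (hden 0 h0)).congr_deriv ?_
    rw [← hb]
    have := hden 0 h0
    rw [← hb] at this
    field_simp
    ring
  rw [hder.deriv, norm_div, Complex.add_conj, div_one] at key
  have hn : ‖((2 * b.re : ℝ) : ℂ)‖ = 2 * (-b.re) := by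
    rw [Complex.norm_real, Real.norm_eq_abs, abs_of_neg (by linarith)]
    ring
  rw [hn, div_le_one (by linarith)] at key
  exact key

/-- After a rotation making `f 0` a nonnegative real, `e f - 1` maps into the left half-plane and
has real part `-(1 - ‖f 0‖)` at `0`. -/
theorem norm_deriv_le_of_mapsTo_ball {f : ℂ → ℂ} (hd : DifferentiableOn ℂ f (Metric.ball 0 1))
    (hf : ∀ ζ ∈ Metric.ball (0 : ℂ) 1, ‖f ζ‖ < 1) :
    ‖deriv f 0‖ ≤ 2 * (1 - ‖f 0‖) := by
  obtain ⟨e, he, hef⟩ : ∃ e : ℂ, ‖e‖ = 1 ∧ e * f 0 = ‖f 0‖ := by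
    rcases eq_or_ne (f 0) 0 with h | h
    · exact ⟨1, by simp, by simp [h]⟩
    · refine ⟨‖f 0‖ / f 0, ?_, by field_simp⟩
      simp [h]
  have hdiff := (hd.differentiableAt (Metric.ball_mem_nhds 0 one_pos)).hasDerivAt
  have := norm_deriv_le_of_re_neg (ψ := fun ζ => e * f ζ - 1) ((hd.const_mul e).sub_const 1) (by
    intro ζ hζ
    have h1 := Complex.re_le_norm (e * f ζ)
    rw [norm_mul, he, one_mul] at h1
    have := hf ζ hζ
    simp only [Complex.sub_re, Complex.one_re]
    linarith)
  rw [((hdiff.const_mul e).sub_const 1).deriv, norm_mul, he, one_mul, hef] at this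
  simpa using this

/-- Schwarz's lemma for maps of the unit disc into the punctured unit disc. -/
theorem norm_deriv_le_of_mapsTo_punctured {g : ℂ → ℂ}
    (hd : DifferentiableOn ℂ g (Metric.ball 0 1))
    (hg : ∀ ζ ∈ Metric.ball (0 : ℂ) 1, g ζ ≠ 0 ∧ ‖g ζ‖ < 1) :
    ‖deriv g 0‖ ≤ 2 * ‖g 0‖ * (-Real.log ‖g 0‖) := by
  have h0 : (0 : ℂ) ∈ Metric.ball (0 : ℂ) 1 := by simp
  have hop : IsOpen (Metric.ball (0 : ℂ) 1) := Metric.isOpen_ball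
  have hdd : DifferentiableOn ℂ (fun ζ => deriv g ζ / g ζ) (Metric.ball 0 1) :=
    (hd.deriv hop).div hd fun ζ hζ => (hg ζ hζ).1
  -- `ψ` is a branch of `log g`: a primitive of `g'/g` with the right value at `0`.
  obtain ⟨ψ, hψ0, hψ⟩ := hdd.isExactOn_ball.with_val_at 0 (Complex.log (g 0))
  have hψd : DifferentiableOn ℂ ψ (Metric.ball 0 1) := fun ζ hζ =>
    (hψ ζ hζ).differentiableAt.differentiableWithinAt
  have hexp : ∀ ζ ∈ Metric.ball (0 : ℂ) 1, g ζ * Complex.exp (-ψ ζ) = 1 := by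
    have hc : ∀ ζ ∈ Metric.ball (0 : ℂ) 1,
        HasDerivAt (fun ζ => g ζ * Complex.exp (-ψ ζ)) 0 ζ := by
      intro ζ hζ
      refine ((hd.differentiableAt (hop.mem_nhds hζ)).hasDerivAt.mul
        ((hψ ζ hζ).neg.cexp)).congr_deriv ?_
      have := (hg ζ hζ).1
      field_simp
      ring
    intro ζ hζ
    have := (convex_ball (0 : ℂ) 1).is_const_of_fderivWithin_eq_zero (𝕜 := ℂ)
      (f := fun ζ => g ζ * Complex.exp (-ψ ζ))
      (fun z hz => (hc z hz).differentiableAt.differentiableWithinAt)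
      (fun z hz => by
        rw [fderivWithin_of_isOpen hop hz]
        ext
        simp [(hc z hz).deriv]) hζ h0
    rw [this, hψ0, Complex.exp_neg, Complex.exp_log (hg 0 h0).1, mul_inv_cancel₀ (hg 0 h0).1]
  have hnorm : ∀ ζ ∈ Metric.ball (0 : ℂ) 1, (ψ ζ).re = Real.log ‖g ζ‖ := by
    intro ζ hζ
    have h1 : g ζ = Complex.exp (ψ ζ) := by
      have := hexp ζ hζ
      rw [Complex.exp_neg] at this
      field_simp at this
      exact this
    rw [h1, Complex.norm_exp, Real.log_exp]
  have := norm_deriv_le_of_re_neg hψd (fun ζ hζ => by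
    rw [hnorm ζ hζ]
    exact Real.log_neg (norm_pos_iff.2 (hg ζ hζ).1) (hg ζ hζ).2)
  rw [(hψ 0 h0).deriv, hnorm 0 h0, norm_div, div_le_iff₀ (norm_pos_iff.2 (hg 0 h0).1)] at this
  linarith

/-! ### From bounds on discs to bounds on curve lengths -/

/-- A lower bound for the Kobayashi metric from a bound on the derivative of an entire function
along all holomorphic discs in `Ω`. -/
theorem le_kobayashiMetric_of_disc_bound {Ω : Set (ℂ × ℂ)} {W : ℂ × ℂ → ℂ}
    (hW : Differentiable ℂ W) {x : ℂ × ℂ} {t : ℝ}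
    (h : ∀ f : ℂ → ℂ × ℂ, DifferentiableOn ℂ f (Metric.ball 0 1) →
      MapsTo f (Metric.ball 0 1) Ω → f 0 = x → t * ‖deriv (W ∘ f) 0‖ ≤ 1) (ξ : ℂ × ℂ) :
    ENNReal.ofReal (t * ‖fderiv ℂ W x ξ‖) ≤ kobayashiMetric Ω x ξ := by
  apply le_sInf
  rintro _ ⟨r, f, hr, rfl, hd, hmaps, hf0, rfl⟩
  apply ENNReal.ofReal_le_ofReal
  have hfd := (hd.differentiableAt (Metric.ball_mem_nhds 0 one_pos)).hasDerivAt
  have hc : HasDerivAt (W ∘ f) (fderiv ℂ W x (deriv f 0)) 0 := by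
    rw [← hf0]
    exact (hW (f 0)).hasFDerivAt.comp_hasDerivAt 0 hfd
  have := h f hd hmaps hf0
  rw [hc.deriv] at this
  rw [map_smul, norm_smul, Complex.norm_real, Real.norm_of_nonneg hr.le]
  nlinarith

/-- A function along a piecewise smooth curve whose derivative is dominated by the Kobayashi
metric changes by at most the length of the curve. -/
theorem enorm_sub_le_kobayashiLength {Ω : Set (ℂ × ℂ)} {γ : ℝ → ℂ × ℂ} (hγ : PiecewiseSmooth γ)
    {τ : ℝ} (hτ : τ ∈ Icc (0 : ℝ) 1) {θ : ℝ → ℝ} {A : ℝ≥0∞} (hA : A ≠ ⊤)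
    (hθ : ∀ s ⊆ Icc 0 τ, ContDiffOn ℝ 1 γ s → ContDiffOn ℝ 1 θ s)
    (hb : ∀ t ∈ Ioo 0 τ, DifferentiableAt ℝ γ t →
      ‖deriv θ t‖ₑ ≤ A * kobayashiMetric Ω (γ t) (deriv γ t)) :
    ‖θ τ - θ 0‖ₑ ≤ A * kobayashiLength Ω γ := by
  obtain ⟨-, n, t, htm, ht0, htn, hts⟩ := hγ
  -- The partition is cut off at `τ`; subintervals beyond `τ` collapse to a point.
  set s : ℕ → ℝ := fun i => min (t i) τ with hs
  have hsm : Monotone s := fun i j hij => min_le_min_right _ (htm hij)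
  have hs0 : s 0 = 0 := by simp [hs, ht0, hτ.1]
  have hsn : s n = τ := by simp [hs, htn, hτ.2]
  have hspos : ∀ i, 0 ≤ s i := fun i => hs0 ▸ hsm (Nat.zero_le i)
  have key : ∀ i ≤ n, ‖θ (s i) - θ 0‖ₑ ≤
      ∫⁻ u in Ioc 0 (s i), A * kobayashiMetric Ω (γ u) (deriv γ u) := by
    intro i
    induction i with
    | zero => intro _; simp [hs0]
    | succ i ih =>
      intro hi
      have hle : s i ≤ s (i + 1) := hsm (Nat.le_succ i)
      have hsub : Icc (s i) (s (i + 1)) ⊆ Icc 0 τ :=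
        Icc_subset_Icc (hspos i) (min_le_right _ _)
      rcases le_total τ (t i) with h | h
      · have h1 : s i = τ := min_eq_right h
        have h2 : s (i + 1) = τ := min_eq_right (h.trans (htm (Nat.le_succ i)))
        rw [h2, ← h1]
        exact ih (Nat.le_of_succ_le hi)
      have hsub' : Icc (s i) (s (i + 1)) ⊆ Icc (t i) (t (i + 1)) := by
        have : s i = t i := min_eq_left h
        rw [this]
        exact Icc_subset_Icc le_rfl (min_le_left _ _)
      have hγs : ContDiffOn ℝ 1 γ (Icc (s i) (s (i + 1))) :=
        ((hts i hi).mono hsub').of_le (by exact_mod_cast le_top)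
      have hstep : ‖θ (s (i + 1)) - θ (s i)‖ₑ ≤
          ∫⁻ u in Ioc (s i) (s (i + 1)), A * kobayashiMetric Ω (γ u) (deriv γ u) := by
        refine (enorm_sub_le_lintegral_deriv_of_contDiffOn_Icc (hθ _ hsub hγs) hle).trans ?_
        rw [← restrict_Ioo_eq_restrict_Icc, ← restrict_Ioo_eq_restrict_Ioc]
        refine setLIntegral_mono' measurableSet_Ioo fun u hu => ?_
        refine hb u ⟨(hspos i).trans_lt hu.1, hu.2.trans_le (min_le_right _ _)⟩ ?_
        exact ((hγs.differentiableOn one_ne_zero) u (Ioo_subset_Icc_self hu)).differentiableAt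
          (Icc_mem_nhds hu.1 hu.2)
      rw [← Ioc_union_Ioc_eq_Ioc (hspos i) hle, lintegral_union measurableSet_Ioc
        (Ioc_disjoint_Ioc_of_le le_rfl)]
      calc ‖θ (s (i + 1)) - θ 0‖ₑ
          = ‖(θ (s i) - θ 0) + (θ (s (i + 1)) - θ (s i))‖ₑ := by congr 1; ring
        _ ≤ _ := (enorm_add_le _ _).trans (add_le_add (ih (Nat.le_of_succ_le hi)) hstep)
  have := key n le_rfl
  -- Finiteness of `A` lets it leave the integral without measurability of the metric along `γ`.
  rw [hsn, lintegral_const_mul' _ _ hA] at this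
  refine this.trans (mul_le_mul_right ?_ _)
  exact lintegral_mono_set (Ioc_subset_Icc_self.trans (Icc_subset_Icc le_rfl hτ.2))

/-- A function `Φ` of the squared modulus of an entire function `W`, evaluated along a curve,
changes by at most a multiple of the Kobayashi length, once it does so infinitesimally along
holomorphic discs. -/
theorem ofReal_abs_sub_le_kobayashiLength {Ω : Set (ℂ × ℂ)} {γ : ℝ → ℂ × ℂ}
    (hγ : PiecewiseSmooth γ) {τ : ℝ} (hτ : τ ∈ Icc (0 : ℝ) 1) {W : ℂ × ℂ → ℂ}
    (hW : ContDiff ℂ 1 W) {Φ : ℝ → ℝ} (hΦ : ∀ t ∈ Icc 0 τ, ContDiffAt ℝ 1 Φ (‖W (γ t)‖ ^ 2))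
    {A : ℝ} (hA : 0 < A)
    (hb : ∀ t ∈ Ioo 0 τ, ∀ f : ℂ → ℂ × ℂ, DifferentiableOn ℂ f (Metric.ball 0 1) →
      MapsTo f (Metric.ball 0 1) Ω → f 0 = γ t →
      2 * ‖W (γ t)‖ * |deriv Φ (‖W (γ t)‖ ^ 2)| * ‖deriv (W ∘ f) 0‖ ≤ A) :
    ENNReal.ofReal |Φ (‖W (γ τ)‖ ^ 2) - Φ (‖W (γ 0)‖ ^ 2)| ≤
      ENNReal.ofReal A * kobayashiLength Ω γ := by
  have hWd : Differentiable ℂ W := hW.differentiable one_ne_zero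
  have hWR : ContDiff ℝ 1 W := hW.restrict_scalars ℝ
  rw [← Real.norm_eq_abs, ofReal_norm]
  refine enorm_sub_le_kobayashiLength (θ := fun t => Φ (‖W (γ t)‖ ^ 2)) hγ hτ
    ENNReal.ofReal_ne_top ?_ ?_
  · intro s hs hγs t ht
    have h1 : ContDiffWithinAt ℝ 1 (fun t => ‖W (γ t)‖ ^ 2) s t :=
      (hWR.contDiffAt.comp_contDiffWithinAt t (hγs t ht)).norm_sq ℝ
    exact (hΦ t (hs ht)).comp_contDiffWithinAt t h1
  -- The derivative is `Φ'(‖W‖²) · 2⟪W, dW(γ')⟫`, bounded by Cauchy–Schwarz; the squared modulus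
  -- keeps it smooth at zeros of `W`.
  · intro t ht hdt
    have hu : HasDerivAt (fun t => W (γ t)) (fderiv ℂ W (γ t) (deriv γ t)) t :=
      ((hWd (γ t)).hasFDerivAt.restrictScalars ℝ).comp_hasDerivAt t hdt.hasDerivAt
    have hΦt := ((hΦ t (Ioo_subset_Icc_self ht)).differentiableAt one_ne_zero).hasDerivAt
    have hθ := hΦt.comp t hu.norm_sq
    have hθ' : deriv (fun t => Φ (‖W (γ t)‖ ^ 2)) t = _ := hθ.deriv
    rw [hθ']
    have hK := le_kobayashiMetric_of_disc_bound (Ω := Ω) hWd (x := γ t)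
      (t := 2 * ‖W (γ t)‖ * |deriv Φ (‖W (γ t)‖ ^ 2)| / A) (by
        intro f hf hm h0
        rw [div_mul_eq_mul_div, div_le_one hA]
        exact hb t ht f hf hm h0) (deriv γ t)
    refine le_trans ?_ (mul_le_mul_right hK _)
    rw [← ENNReal.ofReal_mul hA.le, ← ofReal_norm]
    apply ENNReal.ofReal_le_ofReal
    rw [norm_mul, Real.norm_eq_abs, Real.norm_eq_abs, abs_mul, abs_two]
    have hi := abs_real_inner_le_norm (W (γ t)) (fderiv ℂ W (γ t) (deriv γ t))
    have h0 := abs_nonneg (deriv Φ (‖W (γ t)‖ ^ 2))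
    have : A * (2 * ‖W (γ t)‖ * |deriv Φ (‖W (γ t)‖ ^ 2)| / A *
        ‖fderiv ℂ W (γ t) (deriv γ t)‖) = |deriv Φ (‖W (γ t)‖ ^ 2)| *
        (2 * (‖W (γ t)‖ * ‖fderiv ℂ W (γ t) (deriv γ t)‖)) := by
      field_simp
    rw [this]
    gcongr

/-- A continuous function that passes from above `c` to at most `c` has a first time at `c`. -/
theorem exists_first_hitting_time {u : ℝ → ℝ} (hu : ContinuousOn u (Icc 0 1)) {c : ℝ}
    (h0 : c < u 0) (h1 : u 1 ≤ c) :
    ∃ τ ∈ Icc (0 : ℝ) 1, u τ = c ∧ ∀ t ∈ Ico 0 τ, c < u t := by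
  have hcl : IsCompact (Icc (0 : ℝ) 1 ∩ u ⁻¹' Iic c) :=
    isCompact_Icc.of_isClosed_subset (hu.preimage_isClosed_of_isClosed isClosed_Icc isClosed_Iic)
      inter_subset_left
  obtain ⟨τ, ⟨hτ, hτc⟩, hmin⟩ := hcl.exists_isLeast ⟨1, ⟨by simp, h1⟩⟩
  refine ⟨τ, hτ, ?_, fun t ht => ?_⟩
  · obtain ⟨t, ht, htc⟩ := intermediate_value_Icc' hτ.1
      (hu.mono (Icc_subset_Icc le_rfl hτ.2)) ⟨hτc, h0.le⟩
    have : τ ≤ t := hmin ⟨⟨ht.1, ht.2.trans hτ.2⟩, htc.le⟩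
    rw [le_antisymm this ht.2, htc]
  · by_contra! h
    exact absurd (hmin ⟨⟨ht.1, ht.2.le.trans hτ.2⟩, h⟩) (not_le.2 ht.2)

/-! ### Dynamics of the skew product and its basin -/

theorem skewMap_contDiff (a : ℂ) {n : WithTop ℕ∞} : ContDiff ℂ n (skewMap a) := by
  unfold skewMap
  fun_prop

theorem skewMap_iterate_contDiff (a : ℂ) {n : WithTop ℕ∞} (k : ℕ) :
    ContDiff ℂ n (skewMap a)^[k] := by
  induction k with
  | zero => exact contDiff_id
  | succ k ih => exact ih.comp (skewMap_contDiff a)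

theorem skewMap_iterate_fst (a : ℂ) (n : ℕ) (x : ℂ × ℂ) :
    ((skewMap a)^[n] x).1 = x.1 ^ 2 ^ n := by
  induction n with
  | zero => simp
  | succ n ih => rw [Function.iterate_succ_apply', skewMap, ih, pow_succ 2 n, pow_mul]

theorem iterate_mem_attractingBasin {F : ℂ × ℂ → ℂ × ℂ} {x₀ x : ℂ × ℂ} (k : ℕ) :
    F^[k] x ∈ attractingBasin F x₀ ↔ x ∈ attractingBasin F x₀ := by
  simp only [attractingBasin, mem_ofPred_eq, ← Function.iterate_add_apply]
  exact tendsto_add_atTop_iff_nat (f := fun n => F^[n] x) k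

theorem norm_fst_lt_one_of_mem_basin {a : ℂ} {x : ℂ × ℂ}
    (hx : x ∈ attractingBasin (skewMap a) (0, 0)) : ‖x.1‖ < 1 := by
  by_contra! h
  have h1 : Tendsto (fun n : ℕ => ‖((skewMap a)^[n] x).1‖) atTop (𝓝 0) := by
    simpa using ((continuous_fst.tendsto _).comp hx).norm
  obtain ⟨n, hn⟩ := (h1.eventually_lt_const one_pos).exists
  rw [skewMap_iterate_fst, norm_pow] at hn
  exact absurd hn (not_lt.2 (one_le_pow₀ h))

/-- Since `|z| < 1` along the orbit, `|w| ≥ |a| + 2` is preserved: `|w² + a z| ≥ (|a| + 2)² - |a|`.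
-/
theorem norm_snd_lt_of_mem_basin {a : ℂ} {x : ℂ × ℂ}
    (hx : x ∈ attractingBasin (skewMap a) (0, 0)) : ‖x.2‖ < ‖a‖ + 2 := by
  by_contra! h
  have ha := norm_nonneg a
  have h1 : Tendsto (fun n : ℕ => ‖((skewMap a)^[n] x).2‖) atTop (𝓝 0) := by
    simpa using ((continuous_snd.tendsto _).comp hx).norm
  have h2 : ∀ n : ℕ, ‖a‖ + 2 ≤ ‖((skewMap a)^[n] x).2‖ := by
    intro n
    induction n with
    | zero => simpa using h
    | succ n ih =>
      have hz := norm_fst_lt_one_of_mem_basin ((iterate_mem_attractingBasin n).2 hx)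
      rw [Function.iterate_succ_apply', skewMap]
      set y := (skewMap a)^[n] x
      have h3 := norm_sub_le_norm_add (y.2 ^ 2) (a * y.1)
      rw [norm_pow, norm_mul] at h3
      nlinarith [mul_le_mul_of_nonneg_left hz.le ha]
  obtain ⟨n, hn⟩ := (h1.eventually_lt_const (show (0 : ℝ) < ‖a‖ + 2 by linarith)).exists
  exact absurd hn (not_lt.2 (h2 n))

/-- `F` is homogeneous for the weights `(2, 1)`: each application replaces the scaling by `l` with
that by `l²`. -/
theorem skewMap_iterate_scale (a l : ℂ) (x : ℂ × ℂ) (n : ℕ) :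
    (skewMap a)^[n] (l ^ 2 * x.1, l * x.2) =
      ((l ^ 2 ^ n) ^ 2 * ((skewMap a)^[n] x).1, l ^ 2 ^ n * ((skewMap a)^[n] x).2) := by
  induction n with
  | zero => simp
  | succ n ih =>
    rw [Function.iterate_succ_apply', ih, Function.iterate_succ_apply', skewMap, skewMap]
    ext <;> simp only [pow_succ 2 n, pow_mul] <;> ring

theorem scale_mem_basin {a l : ℂ} (hl : ‖l‖ ≤ 1) {x : ℂ × ℂ}
    (hx : x ∈ attractingBasin (skewMap a) (0, 0)) :
    (l ^ 2 * x.1, l * x.2) ∈ attractingBasin (skewMap a) (0, 0) := by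
  have hx' : Tendsto (fun n : ℕ => (skewMap a)^[n] x) atTop (𝓝 0) := hx
  change Tendsto _ _ (𝓝 0)
  refine squeeze_zero_norm (fun n => ?_) (by simpa using hx'.norm)
  rw [skewMap_iterate_scale, Prod.norm_def, Prod.norm_def]
  have h1 : ‖l ^ 2 ^ n‖ ≤ 1 := by
    rw [norm_pow]
    exact pow_le_one₀ (norm_nonneg _) hl
  apply max_le_max
  · rw [norm_mul, norm_pow (l ^ 2 ^ n)]
    exact mul_le_of_le_one_left (norm_nonneg _) (pow_le_one₀ (norm_nonneg _) h1)
  · rw [norm_mul]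
    exact mul_le_of_le_one_left (norm_nonneg _) h1

/-- The basin of the origin is connected, since it is invariant under the contractions
`(z, w) ↦ (l² z, l w)`. -/
theorem immediateBasin_skewMap (a : ℂ) :
    immediateBasin (skewMap a) (0, 0) = attractingBasin (skewMap a) (0, 0) := by
  refine Subset.antisymm (connectedComponentIn_subset _ _) fun x hx => ?_
  set c : ℝ → ℂ × ℂ := fun l => ((l : ℂ) ^ 2 * x.1, (l : ℂ) * x.2) with hc
  have hcc : Continuous c := by fun_prop
  have hpre : IsPreconnected (c '' Icc 0 1) := isPreconnected_Icc.image c hcc.continuousOn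
  refine hpre.subset_connectedComponentIn ⟨0, by simp, by simp [hc]⟩ ?_ ⟨1, by simp, by simp [hc]⟩
  rintro _ ⟨l, hl, rfl⟩
  refine scale_mem_basin ?_ hx
  rw [Complex.norm_real, Real.norm_of_nonneg hl.1]
  exact hl.2

theorem zero_mk_iterate (a w : ℂ) (n : ℕ) :
    (skewMap a)^[n] (0, w) = (0, w ^ 2 ^ n) := by
  induction n with
  | zero => simp
  | succ n ih => rw [Function.iterate_succ_apply', ih, skewMap]; simp [pow_succ, pow_mul]

theorem tendsto_pow_two_pow {r : ℝ} (h0 : 0 ≤ r) (h1 : r < 1) :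
    Tendsto (fun n : ℕ => r ^ 2 ^ n) atTop (𝓝 0) :=
  (tendsto_pow_atTop_nhds_zero_of_lt_one h0 h1).comp
    (tendsto_pow_atTop_atTop_of_one_lt one_lt_two)

theorem zero_mk_mem_basin (a : ℂ) {w : ℂ} (hw : ‖w‖ < 1) :
    (0, w) ∈ attractingBasin (skewMap a) (0, 0) := by
  change Tendsto _ _ (𝓝 0)
  refine squeeze_zero_norm (fun n => ?_) (tendsto_pow_two_pow (norm_nonneg w) hw)
  rw [zero_mk_iterate, Prod.norm_def]
  simp

/-- Points near the origin are attracted at a definite rate. -/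
theorem iterate_le_of_small {a : ℂ} {x : ℂ × ℂ} (hw : ‖x.2‖ ≤ 1 / 4)
    (hz : 16 * (‖a‖ + 1) * ‖x.1‖ ≤ 1) (n : ℕ) :
    ‖((skewMap a)^[n] x).2‖ ≤ (1 / 2) ^ 2 ^ n / 2 ∧
      4 * (‖a‖ + 1) * ‖((skewMap a)^[n] x).1‖ ≤ ((1 / 2) ^ 2 ^ n) ^ 2 := by
  induction n with
  | zero => constructor <;> simp only [Function.iterate_zero, id, pow_zero, pow_one] <;> linarith
  | succ n ih =>
    rw [Function.iterate_succ_apply', skewMap, pow_succ 2 n, pow_mul]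
    set y := (skewMap a)^[n] x
    set L : ℝ := (1 / 2) ^ 2 ^ n
    have ha := norm_nonneg a
    have hy1 := norm_nonneg y.1
    have hy2 := norm_nonneg y.2
    constructor
    -- Both `|w|²` and `|a z|` are at most `L²/4`.
    · refine (norm_add_le _ _).trans ?_
      rw [norm_pow, norm_mul]
      nlinarith [pow_le_pow_left₀ hy2 ih.1 2]
    · rw [norm_pow]
      have h1 : ‖y.1‖ * (4 * (‖a‖ + 1)) ≤ L ^ 2 := by linarith [ih.2]
      have h2 : ‖y.1‖ ≤ ‖y.1‖ * (4 * (‖a‖ + 1)) := le_mul_of_one_le_right hy1 (by linarith)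
      have h3 := mul_le_mul h1 (h2.trans h1) hy1 (sq_nonneg L)
      nlinarith [h3]

theorem mem_basin_of_small {a : ℂ} {x : ℂ × ℂ} (hw : ‖x.2‖ ≤ 1 / 4)
    (hz : 16 * (‖a‖ + 1) * ‖x.1‖ ≤ 1) : x ∈ attractingBasin (skewMap a) (0, 0) := by
  change Tendsto _ _ (𝓝 0)
  refine squeeze_zero_norm (fun n => ?_)
    (tendsto_pow_two_pow (r := 1 / 2) (by norm_num) (by norm_num))
  obtain ⟨h1, h2⟩ := iterate_le_of_small hw hz n
  have hL0 : (0 : ℝ) ≤ (1 / 2) ^ 2 ^ n := by positivity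
  have hL1 : ((1 / 2) ^ 2 ^ n : ℝ) ≤ 1 := pow_le_one₀ (by norm_num) (by norm_num)
  rw [Prod.norm_def]
  refine max_le ?_ (by linarith)
  have := norm_nonneg ((skewMap a)^[n] x).1
  nlinarith [mul_nonneg (norm_nonneg a) this]

/-- Where `w²` dominates `z`, the second coordinate of the orbit never vanishes. -/
theorem iterate_snd_ne_zero {a : ℂ} {x : ℂ × ℂ} (hw : x.2 ≠ 0)
    (hz : 2 * (‖a‖ + 1) * ‖x.1‖ ≤ ‖x.2‖ ^ 2) (n : ℕ) :
    ((skewMap a)^[n] x).2 ≠ 0 ∧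
      2 * (‖a‖ + 1) * ‖((skewMap a)^[n] x).1‖ ≤ ‖((skewMap a)^[n] x).2‖ ^ 2 := by
  induction n with
  | zero => exact ⟨hw, hz⟩
  | succ n ih =>
    rw [Function.iterate_succ_apply', skewMap]
    set y := (skewMap a)^[n] x
    have ha := norm_nonneg a
    have hy1 := norm_nonneg y.1
    have hy2 := norm_pos_iff.2 ih.1
    have h3 := norm_sub_le_norm_add (y.2 ^ 2) (a * y.1)
    rw [norm_pow, norm_mul] at h3
    have h4 : (‖a‖ + 2) * ‖y.1‖ ≤ ‖y.2 ^ 2 + a * y.1‖ := by nlinarith [ih.2]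
    constructor
    · rw [← norm_pos_iff]
      nlinarith [ih.2, mul_nonneg ha hy1, pow_pos hy2 2]
    · rw [norm_pow]
      refine le_trans ?_ (pow_le_pow_left₀ (by positivity) h4 2)
      nlinarith [sq_nonneg ‖y.1‖, mul_nonneg ha (sq_nonneg ‖y.1‖),
        mul_nonneg (mul_nonneg ha ha) (sq_nonneg ‖y.1‖)]

/-! ### Nonvanishing of iterates along discs -/

/-- Around points of the basin where `w²` dominates `z` after `m` iterations, holomorphic discs in
the basin avoid the zeros of all later iterates on a concentric disc of uniform radius. -/
theorem exists_radius_iterate_ne_zero (a : ℂ) (m : ℕ) :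
    ∃ r : ℝ, 0 < r ∧ r ≤ 1 ∧ ∀ f : ℂ → ℂ × ℂ, DifferentiableOn ℂ f (Metric.ball 0 1) →
      MapsTo f (Metric.ball 0 1) (attractingBasin (skewMap a) (0, 0)) →
      1 / 4 ≤ ‖((skewMap a)^[m] (f 0)).2‖ →
      256 * (‖a‖ + 1) * ‖((skewMap a)^[m] (f 0)).1‖ ≤ 1 →
      ∀ n ≥ m, ∀ ζ ∈ Metric.ball (0 : ℂ) r, ((skewMap a)^[n] (f ζ)).2 ≠ 0 := by
  have ha := norm_nonneg a
  set M := ‖a‖ + 2 with hM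
  -- An error `κ` leaves `|w| ≥ 1/8` and `(|a| + 1)|z| ≤ 1/128`, hence `2(|a| + 1)|z| ≤ 1/64 ≤
  -- |w|²`.
  set κ : ℝ := min (1 / 8) (1 / (256 * (‖a‖ + 1))) with hκ
  have hκ0 : 0 < κ := by positivity
  have huc : UniformContinuousOn (skewMap a)^[m] (Metric.closedBall 0 M) :=
    (isCompact_closedBall _ _).uniformContinuousOn_of_continuous
      (skewMap_iterate_contDiff a (n := 0) m).continuous.continuousOn
  obtain ⟨η, hη, hηd⟩ := Metric.uniformContinuousOn_iff.1 huc κ hκ0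
  refine ⟨min 1 (η / (2 * M)), by positivity, min_le_left _ _, ?_⟩
  intro f hf hmaps hw hz n hn ζ hζ
  have hball : ∀ y ∈ attractingBasin (skewMap a) (0, 0), ‖y‖ ≤ M := fun y hy => by
    rw [Prod.norm_def]
    exact max_le (by linarith [norm_fst_lt_one_of_mem_basin hy]) (norm_snd_lt_of_mem_basin hy).le
  have hζr : ‖ζ‖ < min 1 (η / (2 * M)) := by simpa using hζ
  have hζ1 : ζ ∈ Metric.ball (0 : ℂ) 1 := by simpa using hζr.trans_le (min_le_left _ _)
  have h01 : (0 : ℂ) ∈ Metric.ball (0 : ℂ) 1 := by simp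
  have hdist : dist (f ζ) (f 0) < η := by
    have h1 := Complex.dist_le_div_mul_dist_of_mapsTo_ball (R₂ := 2 * M) hf (fun y hy => by
      rw [Metric.mem_closedBall, dist_eq_norm]
      exact (norm_sub_le _ _).trans (by linarith [hball _ (hmaps hy), hball _ (hmaps h01)])) hζ1
    rw [dist_zero_right, div_one] at h1
    have h2 := hζr.trans_le (min_le_right _ _)
    rw [lt_div_iff₀ (by positivity)] at h2
    linarith
  have hd := hηd _ (by simpa using hball _ (hmaps hζ1)) _ (by simpa using hball _ (hmaps h01)) hdist
  rw [dist_eq_norm, Prod.norm_def, max_lt_iff] at hd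
  set y := (skewMap a)^[m] (f ζ) with hy
  set x := (skewMap a)^[m] (f 0)
  have h1 : ‖y.1‖ ≤ ‖x.1‖ + 1 / (256 * (‖a‖ + 1)) := by
    have := norm_le_norm_add_norm_sub' y.1 x.1
    have h2 : ‖y.1 - x.1‖ < κ := hd.1
    linarith [min_le_right (1 / 8 : ℝ) (1 / (256 * (‖a‖ + 1)))]
  have h2 : 1 / 8 ≤ ‖y.2‖ := by
    have := norm_le_norm_add_norm_sub' x.2 y.2
    have h2 : ‖y.2 - x.2‖ < κ := hd.2
    rw [norm_sub_rev] at h2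
    linarith [min_le_left (1 / 8 : ℝ) (1 / (256 * (‖a‖ + 1)))]
  have h3 : 128 * (‖a‖ + 1) * ‖y.1‖ ≤ 1 := by
    have h4 : 128 * (‖a‖ + 1) * ‖y.1‖ ≤
        128 * (‖a‖ + 1) * (‖x.1‖ + 1 / (256 * (‖a‖ + 1))) := by gcongr
    have h5 : 128 * (‖a‖ + 1) * (‖x.1‖ + 1 / (256 * (‖a‖ + 1))) =
        (256 * (‖a‖ + 1) * ‖x.1‖) / 2 + 1 / 2 := by
      field_simp
      ring
    linarith
  have := (iterate_snd_ne_zero (a := a) (x := y) (norm_pos_iff.1 (by linarith))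
    (by nlinarith) (n - m)).1
  rwa [hy, ← Function.iterate_add_apply, Nat.sub_add_cancel hn] at this

/-- The derivative bound along holomorphic discs in the basin on which an iterate does not vanish. -/
theorem norm_deriv_iterate_snd_le {a : ℂ} {n : ℕ} {r : ℝ} (hr : 0 < r) (hr1 : r ≤ 1)
    {f : ℂ → ℂ × ℂ} (hf : DifferentiableOn ℂ f (Metric.ball 0 1))
    (hmaps : MapsTo f (Metric.ball 0 1) (attractingBasin (skewMap a) (0, 0)))
    (hne : ∀ ζ ∈ Metric.ball (0 : ℂ) r, ((skewMap a)^[n] (f ζ)).2 ≠ 0) :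
    r * ‖deriv ((fun x => ((skewMap a)^[n] x).2) ∘ f) 0‖ ≤
      2 * ‖((skewMap a)^[n] (f 0)).2‖ *
        (Real.log (‖a‖ + 2) - Real.log ‖((skewMap a)^[n] (f 0)).2‖) := by
  have ha := norm_nonneg a
  set M := ‖a‖ + 2 with hM
  have hM0 : 0 < M := by linarith
  set W : ℂ × ℂ → ℂ := fun x => ((skewMap a)^[n] x).2 with hW
  have hWd : Differentiable ℂ W :=
    ((skewMap_iterate_contDiff a (n := 1) n).differentiable one_ne_zero).snd
  have hWf : DifferentiableOn ℂ (W ∘ f) (Metric.ball 0 1) := hWd.comp_differentiableOn hf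
  have hscale : ∀ ζ ∈ Metric.ball (0 : ℂ) 1, (r : ℂ) * ζ ∈ Metric.ball (0 : ℂ) r := by
    intro ζ hζ
    simp only [mem_ball_zero_iff, norm_mul, Complex.norm_real, Real.norm_of_nonneg hr.le] at hζ ⊢
    nlinarith
  have hsub : Metric.ball (0 : ℂ) r ⊆ Metric.ball 0 1 := Metric.ball_subset_ball hr1
  have key := norm_deriv_le_of_mapsTo_punctured (g := fun ζ => (W ∘ f) (r * ζ) / M)
    ((hWf.comp (differentiable_id.const_mul (r : ℂ)).differentiableOn
      fun ζ hζ => hsub (hscale ζ hζ)).div_const _) (by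
    intro ζ hζ
    refine ⟨div_ne_zero (hne _ (hscale ζ hζ)) (by exact_mod_cast hM0.ne'), ?_⟩
    rw [norm_div, Complex.norm_real, Real.norm_of_nonneg hM0.le, div_lt_one hM0]
    exact norm_snd_lt_of_mem_basin
      ((iterate_mem_attractingBasin n).2 (hmaps (hsub (hscale ζ hζ)))))
  have hder : HasDerivAt (fun ζ : ℂ => (W ∘ f) (r * ζ) / M) (deriv (W ∘ f) 0 * r / M) 0 := by
    have h1 : HasDerivAt (W ∘ f) (deriv (W ∘ f) 0) ((r : ℂ) * 0) := by
      rw [mul_zero]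
      exact (hWf.differentiableAt (Metric.ball_mem_nhds 0 one_pos)).hasDerivAt
    have h2 : HasDerivAt (fun ζ : ℂ => (r : ℂ) * ζ) r 0 := by
      simpa using (hasDerivAt_id (0 : ℂ)).const_mul (r : ℂ)
    exact (h1.comp 0 h2).div_const _
  have hW0 : 0 < ‖W (f 0)‖ := norm_pos_iff.2 (hne 0 (by simpa using hr))
  rw [hder.deriv] at key
  simp only [mul_zero, Function.comp_apply, norm_div, norm_mul, Complex.norm_real,
    Real.norm_of_nonneg hr.le, Real.norm_of_nonneg hM0.le] at key
  rw [Real.log_div hW0.ne' hM0.ne', div_le_iff₀ hM0] at key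
  calc r * ‖deriv (W ∘ f) 0‖ = ‖deriv (W ∘ f) 0‖ * r := mul_comm _ _
    _ ≤ _ := key
    _ = 2 * ‖W (f 0)‖ * (Real.log M - Real.log ‖W (f 0)‖) := by field_simp; ring

/-! ### Length of curves, in `z` and in `w` -/

/-- A curve in the basin from the axis `z = 0` to a point with `|z|` close to `1` is long. -/
theorem le_kobayashiLength_of_fst {a : ℂ} {γ : ℝ → ℂ × ℂ} (hγ : PiecewiseSmooth γ)
    (hmaps : MapsTo γ (Icc 0 1) (attractingBasin (skewMap a) (0, 0))) (h0 : (γ 0).1 = 0)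
    {C : ℝ} {t : ℝ} (ht : t ∈ Icc (0 : ℝ) 1)
    (hfar : 1 - ‖(γ t).1‖ ^ 2 ≤ Real.exp (-4 * C)) :
    ENNReal.ofReal C ≤ kobayashiLength (attractingBasin (skewMap a) (0, 0)) γ := by
  have hlt : ∀ s ∈ Icc (0 : ℝ) 1, ‖(γ s).1‖ < 1 := fun s hs =>
    norm_fst_lt_one_of_mem_basin (hmaps hs)
  have hpos : ∀ s ∈ Icc (0 : ℝ) 1, 0 < 1 - ‖(γ s).1‖ ^ 2 := fun s hs => by
    nlinarith [hlt s hs, norm_nonneg (γ s).1]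
  have hsub : Icc 0 t ⊆ Icc (0 : ℝ) 1 := Icc_subset_Icc le_rfl ht.2
  -- `A = 4` works because `2|z| · 2(1 - |z|) ≤ 4(1 - |z|²)`.
  have key := ofReal_abs_sub_le_kobayashiLength (Ω := attractingBasin (skewMap a) (0, 0)) hγ ht
    (W := Prod.fst) contDiff_fst (Φ := fun s => Real.log (1 - s)) (A := 4) (fun s hs =>
      ContDiffAt.log (by fun_prop) (hpos s (hsub hs)).ne') (by norm_num) (by
    intro s hs f hf hm hf0
    have hs1 := hsub (Ioo_subset_Icc_self hs)
    have hd : HasDerivAt (fun s : ℝ => Real.log (1 - s)) (-1 / (1 - ‖(γ s).1‖ ^ 2))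
        (‖(γ s).1‖ ^ 2) :=
      ((hasDerivAt_id _).const_sub 1).log (hpos s hs1).ne'
    rw [hd.deriv, abs_div, abs_neg, abs_one, abs_of_pos (hpos s hs1)]
    have hb := norm_deriv_le_of_mapsTo_ball (f := Prod.fst ∘ f)
      (differentiable_fst.comp_differentiableOn hf)
      (fun ζ hζ => norm_fst_lt_one_of_mem_basin (hm hζ))
    rw [Function.comp_apply, hf0] at hb
    have hn := norm_nonneg (γ s).1
    have hl := hlt s hs1
    rw [mul_one_div, div_mul_eq_mul_div, div_le_iff₀ (hpos s hs1)]
    nlinarith [mul_le_mul_of_nonneg_left hb hn])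
  simp only [h0, norm_zero, ne_eq, OfNat.ofNat_ne_zero, not_false_eq_true, zero_pow, sub_zero,
    Real.log_one] at key
  have h1 : Real.log (1 - ‖(γ t).1‖ ^ 2) ≤ -4 * C := by
    rw [← Real.log_exp (-4 * C)]
    exact Real.log_le_log (hpos t ht) hfar
  have h2 : ENNReal.ofReal (4 * C) ≤ ENNReal.ofReal |Real.log (1 - ‖(γ t).1‖ ^ 2)| :=
    ENNReal.ofReal_le_ofReal (by linarith [neg_le_abs (Real.log (1 - ‖(γ t).1‖ ^ 2))])
  have h3 := h2.trans key
  rw [ENNReal.ofReal_mul (by norm_num)] at h3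
  exact (ENNReal.mul_le_mul_iff_right (by simp) (by simp)).1 h3

/-- A curve in the basin along which `z` stays small after `m` iterations, and along which the
second coordinate of the `n`-th iterate drops substantially, is long. -/
theorem le_kobayashiLength_of_snd {a : ℂ} {γ : ℝ → ℂ × ℂ} (hγ : PiecewiseSmooth γ)
    (hmaps : MapsTo γ (Icc 0 1) (attractingBasin (skewMap a) (0, 0))) {m n : ℕ} (hmn : m ≤ n)
    (hz : ∀ t ∈ Icc (0 : ℝ) 1, 256 * (‖a‖ + 1) * ‖((skewMap a)^[m] (γ t)).1‖ ≤ 1)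
    {r : ℝ} (hr : 0 < r) (hr1 : r ≤ 1)
    (hrad : ∀ f : ℂ → ℂ × ℂ, DifferentiableOn ℂ f (Metric.ball 0 1) →
      MapsTo f (Metric.ball 0 1) (attractingBasin (skewMap a) (0, 0)) →
      1 / 4 ≤ ‖((skewMap a)^[m] (f 0)).2‖ →
      256 * (‖a‖ + 1) * ‖((skewMap a)^[m] (f 0)).1‖ ≤ 1 →
      ∀ ζ ∈ Metric.ball (0 : ℂ) r, ((skewMap a)^[n] (f ζ)).2 ≠ 0)
    {c : ℝ} (hc : c = (1 / 2) ^ 2 ^ (n - m) / 2)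
    (h0 : c < ‖((skewMap a)^[n] (γ 0)).2‖) (h1 : ‖((skewMap a)^[n] (γ 1)).2‖ ≤ c)
    {C : ℝ} (hC : Real.exp (2 / r * C) *
      (Real.log (‖a‖ + 2) - Real.log ‖((skewMap a)^[n] (γ 0)).2‖) ≤
        Real.log (‖a‖ + 2) - Real.log c) :
    ENNReal.ofReal C ≤ kobayashiLength (attractingBasin (skewMap a) (0, 0)) γ := by
  have ha := norm_nonneg a
  set M := ‖a‖ + 2 with hM
  set W : ℂ × ℂ → ℂ := fun x => ((skewMap a)^[n] x).2 with hW
  have hc0 : 0 < c := by rw [hc]; positivity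
  have hWc : ContDiff ℂ 1 W := (skewMap_iterate_contDiff a n).snd
  obtain ⟨τ, hτ, hτc, hτlt⟩ := exists_first_hitting_time (u := fun t => ‖W (γ t)‖)
    (hWc.continuous.comp_continuousOn hγ.1).norm h0 h1
  have hsub : Icc 0 τ ⊆ Icc (0 : ℝ) 1 := Icc_subset_Icc le_rfl hτ.2
  have hWpos : ∀ t ∈ Icc 0 τ, 0 < ‖W (γ t)‖ := by
    intro t ht
    rcases ht.2.lt_or_eq with h | h
    · exact hc0.trans (hτlt t ⟨ht.1, h⟩)
    · rw [h, hτc]; exact hc0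
  have hWM : ∀ t ∈ Icc (0 : ℝ) 1, ‖W (γ t)‖ < M := fun t ht =>
    norm_snd_lt_of_mem_basin ((iterate_mem_attractingBasin n).2 (hmaps ht))
  have hlog : ∀ t ∈ Icc 0 τ, 0 < Real.log M - Real.log ‖W (γ t)‖ := fun t ht =>
    sub_pos.2 (Real.log_lt_log (hWpos t ht) (hWM t (hsub ht)))
  have hsq : ∀ t, Real.log M - Real.log (‖W (γ t)‖ ^ 2) / 2 = Real.log M - Real.log ‖W (γ t)‖ := by
    intro t
    rw [Real.log_pow]
    push_cast
    ring
  -- `Φ(|W|²) = log log (M/|W|)`, a primitive, up to sign, of the radial hyperbolic density of the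
  -- punctured disc.
  have key := ofReal_abs_sub_le_kobayashiLength (Ω := attractingBasin (skewMap a) (0, 0)) hγ hτ
    hWc (Φ := fun s => Real.log (Real.log M - Real.log s / 2)) (A := 2 / r) (fun t ht => by
      refine ContDiffAt.log ?_ (by rw [hsq]; exact (hlog t ht).ne')
      refine contDiffAt_const.sub (ContDiffAt.div_const (ContDiffAt.log contDiffAt_id ?_) 2)
      exact (pow_pos (hWpos t ht) 2).ne') (by positivity) (by
    intro t ht f hf hm hf0
    have htI := Ioo_subset_Icc_self ht
    have hWt := hWpos t htI
    have hL := hlog t htI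
    have hd : HasDerivAt (fun s : ℝ => Real.log (Real.log M - Real.log s / 2))
        (-((1 / ‖W (γ t)‖ ^ 2) / 2) / (Real.log M - Real.log ‖W (γ t)‖)) (‖W (γ t)‖ ^ 2) := by
      rw [← hsq t]
      exact ((((hasDerivAt_id _).log (pow_pos hWt 2).ne').div_const 2).const_sub _).log
        (by rw [id, hsq]; exact hL.ne')
    -- A smaller value would force `|W| ≤ c` at time `t`, before the first hitting time `τ`.
    have hm4 : 1 / 4 ≤ ‖((skewMap a)^[m] (f 0)).2‖ := by
      by_contra! h
      have hs := (iterate_le_of_small (a := a) h.le (by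
        rw [hf0]
        have := hz t (hsub htI)
        nlinarith [mul_nonneg ha (norm_nonneg ((skewMap a)^[m] (γ t)).1),
          norm_nonneg ((skewMap a)^[m] (γ t)).1]) (n - m)).1
      rw [← Function.iterate_add_apply, Nat.sub_add_cancel hmn, hf0, ← hc] at hs
      exact absurd hs (not_le.2 (hτlt t ⟨ht.1.le, ht.2⟩))
    have hb := norm_deriv_iterate_snd_le hr hr1 hf hm
      (hrad f hf hm hm4 (by rw [hf0]; exact hz t (hsub htI)))
    rw [hf0] at hb
    change r * ‖deriv (W ∘ f) 0‖ ≤ 2 * ‖W (γ t)‖ * (Real.log M - Real.log ‖W (γ t)‖) at hb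
    rw [hd.deriv, neg_div, abs_neg, abs_of_pos (by positivity)]
    calc 2 * ‖W (γ t)‖ * (1 / ‖W (γ t)‖ ^ 2 / 2 / (Real.log M - Real.log ‖W (γ t)‖)) *
          ‖deriv (W ∘ f) 0‖
        = (r * ‖deriv (W ∘ f) 0‖) / (r * (‖W (γ t)‖ * (Real.log M - Real.log ‖W (γ t)‖))) := by
          field_simp
      _ ≤ (2 * ‖W (γ t)‖ * (Real.log M - Real.log ‖W (γ t)‖)) /
          (r * (‖W (γ t)‖ * (Real.log M - Real.log ‖W (γ t)‖))) := by gcongr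
      _ = 2 / r := by field_simp)
  simp only [hsq] at key
  have h0τ : (0 : ℝ) ∈ Icc 0 τ := ⟨le_rfl, hτ.1⟩
  have hL0 := hlog 0 h0τ
  have h2 : 2 / r * C ≤ Real.log (Real.log M - Real.log ‖W (γ τ)‖) -
      Real.log (Real.log M - Real.log ‖W (γ 0)‖) := by
    have h3 := Real.log_le_log (by positivity) hC
    rw [Real.log_mul (Real.exp_pos _).ne' hL0.ne', Real.log_exp] at h3
    rw [hτc]
    linarith
  have h3 := (ENNReal.ofReal_le_ofReal (h2.trans (le_abs_self _))).trans key
  rw [ENNReal.ofReal_mul (by positivity)] at h3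
  exact (ENNReal.mul_le_mul_iff_right (by simp [hr]) (by simp)).1 h3

/-! ### Backward orbit points and the choice of constants -/

/-- The second coordinate of late iterates of a backward orbit point of `(ε, 0)`. -/
theorem iterate_snd_le_of_mem_preimage {a : ℂ} {ε : ℝ} (hε : 0 ≤ ε)
    (hε₀ : 16 * (‖a‖ + 1) * ε ≤ 1) {q : ℂ × ℂ} {k m n : ℕ} (hmn : m ≤ n)
    (hq : (skewMap a)^[k] q = ((ε : ℂ), 0))
    (hz : 256 * (‖a‖ + 1) * ‖((skewMap a)^[m] q).1‖ ≤ 1) :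
    ‖((skewMap a)^[n] q).2‖ ≤ (1 / 2) ^ 2 ^ (n - m) / 2 := by
  have ha := norm_nonneg a
  have hz0 := norm_nonneg ((skewMap a)^[m] q).1
  have hza := mul_nonneg ha hz0
  rcases le_or_gt ‖((skewMap a)^[m] q).2‖ (1 / 4) with h | h
  · have := (iterate_le_of_small (a := a) h (by nlinarith) (n - m)).1
    rwa [← Function.iterate_add_apply, Nat.sub_add_cancel hmn] at this
  -- Were `k ≥ m`, the orbit would have nonzero second coordinate at time `k`, yet it is at `(ε,
  -- 0)`.
  · have hkm : k < m := by
      by_contra! hmk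
      refine (iterate_snd_ne_zero (a := a) (x := (skewMap a)^[m] q)
        (norm_pos_iff.1 (by linarith)) (by nlinarith) (k - m)).1 ?_
      rw [← Function.iterate_add_apply, Nat.sub_add_cancel hmk, hq]
    have := (iterate_le_of_small (a := a) (x := ((ε : ℂ), 0)) (by simp)
      (by simpa [abs_of_nonneg hε] using hε₀) (n - k)).1
    rw [← hq, ← Function.iterate_add_apply, Nat.sub_add_cancel (hkm.le.trans hmn)] at this
    refine this.trans ?_
    have h2 : 2 ^ (n - m) ≤ 2 ^ (n - k) := Nat.pow_le_pow_right two_pos (by omega)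
    have := pow_le_pow_of_le_one (show (0 : ℝ) ≤ 1 / 2 by norm_num) (by norm_num) h2
    linarith

theorem theorem4p1 (a : ℂ) (ha : a ≠ 0) :
    ∃ ε₀ : ℝ, 0 < ε₀ ∧ ∀ ε : ℝ, 0 < ε → ε < ε₀ → ∀ C : ℝ, 0 < C →
      ∃ p ∈ immediateBasin (skewMap a) (0, 0),
        ∀ q ∈ ⋃ k : ℕ, (skewMap a)^[k] ⁻¹' {((ε : ℂ), (0 : ℂ))},
          q ∈ immediateBasin (skewMap a) (0, 0) ∧
            ENNReal.ofReal C ≤ kobayashiDist (immediateBasin (skewMap a) (0, 0)) p q := by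
  rw [immediateBasin_skewMap]
  have hna : 0 < ‖a‖ := norm_pos_iff.2 ha
  refine ⟨1 / (16 * (‖a‖ + 1)), by positivity, ?_⟩
  intro ε hε hεlt C hC
  have hε₀ : 16 * (‖a‖ + 1) * ε ≤ 1 := by
    rw [lt_div_iff₀ (by positivity)] at hεlt
    linarith
  set σ : ℝ := Real.sqrt (1 - Real.exp (-4 * C)) with hσ
  have hexp1 : Real.exp (-4 * C) < 1 := Real.exp_lt_one_iff.2 (by linarith)
  have hσ1 : σ < 1 := by
    rw [hσ, Real.sqrt_lt' one_pos]
    linarith [Real.exp_pos (-4 * C)]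
  obtain ⟨m, hm⟩ := ((tendsto_pow_two_pow (Real.sqrt_nonneg _) hσ1).eventually_lt_const
    (show (0 : ℝ) < 1 / (256 * (‖a‖ + 1)) by positivity)).exists
  obtain ⟨r, hr, hr1, hrad⟩ := exists_radius_iterate_ne_zero a m
  -- the base point will be `(0, exp (-s))`
  set s : ℝ := Real.log 2 / (2 ^ m * (2 * Real.exp (2 / r * C))) with hs
  have hl2 : 0 < Real.log 2 := Real.log_pos one_lt_two
  have hs0 : 0 < s := by positivity
  -- Only `n` remains to be chosen, after `m`, `r` and `s`. Now `log M + 2^n s ≤ 2 · 2^n s`, and `s`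
  -- was defined so that `exp (2C/r)` times the right side is `2^(n-m) log 2 ≤ -log c`.
  obtain ⟨n, hnm, hn⟩ : ∃ n ≥ m, Real.log (‖a‖ + 2) ≤ 2 ^ n * s := by
    have h1 : Tendsto (fun n : ℕ => (2 : ℝ) ^ n * s) atTop atTop :=
      (tendsto_pow_atTop_atTop_of_one_lt one_lt_two).atTop_mul_const hs0
    obtain ⟨n, hn1, hn2⟩ := ((eventually_ge_atTop m).and (h1.eventually_ge_atTop _)).exists
    exact ⟨n, hn1, hn2⟩
  set c : ℝ := (1 / 2) ^ 2 ^ (n - m) / 2 with hc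
  have hc0 : 0 < c := by positivity
  have hlogc : Real.log c = -(2 ^ (n - m) * Real.log 2) - Real.log 2 := by
    rw [hc, Real.log_div (by positivity) two_ne_zero, Real.log_pow, one_div, Real.log_inv]
    push_cast
    ring
  have hE : 1 ≤ Real.exp (2 / r * C) := Real.one_le_exp (by positivity)
  have hsn : 2 * Real.exp (2 / r * C) * (2 ^ n * s) = 2 ^ (n - m) * Real.log 2 := by
    have : (2 : ℝ) ^ n = 2 ^ (n - m) * 2 ^ m := by rw [← pow_add, Nat.sub_add_cancel hnm]
    rw [this, hs]
    field_simp
  have hsn0 : 0 < 2 ^ n * s := by positivity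
  have hp : ‖((skewMap a)^[n] (0, (Real.exp (-s) : ℂ))).2‖ = Real.exp (-(2 ^ n * s)) := by
    rw [zero_mk_iterate, norm_pow, Complex.norm_real, Real.norm_of_nonneg (Real.exp_pos _).le,
      ← Real.exp_nat_mul]
    push_cast
    ring_nf
  refine ⟨(0, (Real.exp (-s) : ℂ)), zero_mk_mem_basin a ?_, ?_⟩
  · rw [Complex.norm_real, Real.norm_of_nonneg (Real.exp_pos _).le]
    exact Real.exp_lt_one_iff.2 (by linarith)
  intro q hq
  obtain ⟨k, hk⟩ := mem_iUnion.1 hq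
  have hk' : (skewMap a)^[k] q = ((ε : ℂ), 0) := hk
  refine ⟨(iterate_mem_attractingBasin k).1 ?_, ?_⟩
  · rw [hk']
    exact mem_basin_of_small (by simp) (by simpa [abs_of_pos hε] using hε₀)
  apply le_sInf
  rintro _ ⟨γ, hγ, hmaps, hγ0, hγ1, rfl⟩
  by_cases hfar : ∃ t ∈ Icc (0 : ℝ) 1, 1 - ‖(γ t).1‖ ^ 2 ≤ Real.exp (-4 * C)
  · obtain ⟨t, ht, htf⟩ := hfar
    exact le_kobayashiLength_of_fst hγ hmaps (by rw [hγ0]) ht htf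
  push Not at hfar
  have hz : ∀ t ∈ Icc (0 : ℝ) 1, 256 * (‖a‖ + 1) * ‖((skewMap a)^[m] (γ t)).1‖ ≤ 1 := by
    intro t ht
    rw [skewMap_iterate_fst, norm_pow]
    have h1 : ‖(γ t).1‖ ≤ σ := Real.le_sqrt_of_sq_le (by linarith [hfar t ht])
    have h2 := (pow_le_pow_left₀ (norm_nonneg _) h1 (2 ^ m)).trans hm.le
    rw [le_div_iff₀ (by positivity)] at h2
    linarith
  refine le_kobayashiLength_of_snd hγ hmaps hnm hz hr hr1
    (fun f hf hmf h1 h2 => hrad f hf hmf h1 h2 n hnm) hc ?_ ?_ ?_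
  · rw [hγ0, hp, ← Real.log_lt_iff_lt_exp hc0, hlogc]
    nlinarith
  · have := hz 1 (by simp)
    rw [hγ1] at this ⊢
    exact iterate_snd_le_of_mem_preimage hε.le hε₀ hnm hk' this
  · rw [hγ0, hp, Real.log_exp, hlogc]
    have hM : 0 ≤ Real.log (‖a‖ + 2) := Real.log_nonneg (by linarith)
    nlinarith [mul_le_mul_of_nonneg_left hn (Real.exp_pos (2 / r * C)).le]
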